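/- Let $n$ be a natural number, let $\Omega\subset\mathbb{R}^n$ be compact and convex, and let $f$ be an $\mathbb{R}^n$-valued map that is $C^1$ on an open set $U\supseteq\Omega$. Suppose that the solutions of $\dot x=f(x)$ evolve on the invariant set $\Omega$: for every $x_0\in\Omega$ there is a solution $x:[0,\infty)\to\mathbb{R}^n$ of $\dot x(t)=f(x(t))$, $x(0)=x_0$, with $x(t)\in\Omega$ for all $t\ge 0$ (it is then unique, because $f$ is $C^1$). Suppose moreover that for every $x\in\Omega$ the Jacobian $J(x)=\frac{\partial f}{\partial x}(x)=\left(\frac{\partial f_i}{\partial x_j}(x)\right)_{i,j}$ is tridiagonal with positive entries on the super- and sub-diagonal, that is, $J_{ij}(x)=0$ whenever $|i-j|>1$ and $J_{ij}(x)>0$ whenever $|i-j|=1$. Then for every $x_0\in\Omega$, the solution $x(t,x_0)$ of $\dot x=f(x)$ with $x(0,x_0)=x_0$ converges, as $t\to\infty$, to an equilibrium point, i.e. to some $p\in\Omega$ with $f(p)=0$. -/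

import Mathlib

/-- The Jacobian matrix of `f` at `x`: its `(i, j)` entry is `∂ f_i / ∂ x_j` at `x`. -/
noncomputable def jacobian {n : ℕ} (f : (Fin n → ℝ) → (Fin n → ℝ)) (x : Fin n → ℝ) :
    Matrix (Fin n) (Fin n) ℝ :=
  LinearMap.toMatrix' (fderiv ℝ f x : (Fin n → ℝ) →ₗ[ℝ] (Fin n → ℝ))

/-- The class `𝕄⁺` of tridiagonal matrices all of whose entries on the super-diagonal and on the
sub-diagonal are positive (the diagonal entries are arbitrary). -/
structure IsPositiveTridiagonal {n : ℕ} (A : Matrix (Fin n) (Fin n) ℝ) : Prop where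
  zero_above : ∀ i j : Fin n, (i : ℕ) + 1 < j → A i j = 0
  zero_below : ∀ i j : Fin n, (j : ℕ) + 1 < i → A i j = 0
  pos_super : ∀ i j : Fin n, (i : ℕ) + 1 = j → 0 < A i j
  pos_sub : ∀ i j : Fin n, (j : ℕ) + 1 = i → 0 < A i j

/-- `x` is a solution on `[0, ∞)` of `ẋ = f(x)` with `x(0) = x₀`
(the derivative at `t = 0` is one-sided; the values of `x` at negative times are irrelevant). -/
def IsForwardSolution {n : ℕ} (f : (Fin n → ℝ) → (Fin n → ℝ)) (x₀ : Fin n → ℝ)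
    (x : ℝ → Fin n → ℝ) : Prop :=
  x 0 = x₀ ∧ IsIntegralCurveOn x (fun _ => f) (Set.Ici 0)

/-- The solutions of `ẋ = f(x)` evolve on the invariant set `Ω`: from each initial point in `Ω`
there is a solution for all `t ≥ 0`, and it remains in `Ω`. (For `f` that is `C¹` near a compact
`Ω`, the solution is then automatically unique, so uniqueness is not assumed.) -/
def EvolvesOn {n : ℕ} (f : (Fin n → ℝ) → (Fin n → ℝ)) (Ω : Set (Fin n → ℝ)) : Prop :=
  ∀ x₀ ∈ Ω, ∃ x : ℝ → Fin n → ℝ, IsForwardSolution f x₀ x ∧ ∀ t, 0 ≤ t → x t ∈ Ω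

/-! Along a solution the velocity `v = f(x(t))` solves `v' = J(x(t)) v`. A cooperative tridiagonal
flow creates no sign alternations (`HasAlternation.of_later`): a small Euler step creates none, and
a Gronwall bound on the distance to the closed set of vectors lacking the alternation transfers this
to the flow. If the first entry of `v` took both strict signs at arbitrarily late times,
alternations of every length would occur. So it eventually keeps a weak sign, and the first
coordinate of `x` converges to some `c`.

On the solution through an omega-limit point that coordinate is constantly `c`. Differentiating and
using the positive super-diagonal, the velocity vanishes entry by entry, so the point is an
equilibrium. Rolle's theorem along a segment shows that an equilibrium in the convex set `Ω` is
determined by its first coordinate. The cluster point is therefore unique, and compactness gives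
convergence. -/

open Filter Set Metric Topology

/-! ### Sign alternations and Euler steps -/

/-- The vector `z` has entries, taken in increasing order of their indices, whose signs are
`+, -, +, …` (`k` of them). -/
def HasAlternation {n : ℕ} (k : ℕ) (z : Fin n → ℝ) : Prop :=
  ∃ g : Fin k → Fin n, StrictMono g ∧ ∀ m : Fin k, 0 < (-1) ^ (m : ℕ) * z (g m)

lemma hasAlternation_zero {n : ℕ} (z : Fin n → ℝ) : HasAlternation 0 z :=
  ⟨Fin.elim0, fun a => a.elim0, fun a => a.elim0⟩

lemma HasAlternation.le {n k : ℕ} {z : Fin n → ℝ} (h : HasAlternation k z) : k ≤ n := by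
  obtain ⟨g, hg, -⟩ := h
  simpa using Fintype.card_le_of_injective g hg.injective

/-- A pattern of `-z` starts with a positive entry, hence not at index `0`. Prepending `0` shifts
every position by one, which turns the signs of `-z` into those of `z`. -/
lemma HasAlternation.succ_of_neg {n k : ℕ} {z : Fin (n + 1) → ℝ} (h : HasAlternation k (-z))
    (h0 : 0 < z 0) : HasAlternation (k + 1) z := by
  obtain ⟨g, hg, hz⟩ := h
  refine ⟨Fin.cons 0 g, ?_, ?_⟩
  · rw [Fin.strictMono_iff_lt_succ]
    intro i
    rw [Fin.cons_succ]
    rcases k with _ | k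
    · exact i.elim0
    refine Fin.cases ?_ (fun j => ?_) i
    · simp only [Fin.castSucc_zero, Fin.cons_zero]
      rcases Fin.eq_zero_or_eq_succ (g 0) with h | ⟨j, hj⟩
      · have := hz 0
        rw [h] at this
        simp at this
        linarith
      · rw [hj]
        exact Fin.succ_pos j
    · rw [← Fin.succ_castSucc, Fin.cons_succ]
      exact hg Fin.castSucc_lt_succ
  · intro m
    refine Fin.cases (by simpa using h0) (fun j => ?_) m
    have := hz j
    simp only [Fin.val_succ, Fin.cons_succ, pow_succ, Pi.neg_apply] at this ⊢
    linarith

lemma isOpen_hasAlternation (n k : ℕ) : IsOpen {z : Fin n → ℝ | HasAlternation k z} := by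
  have : {z : Fin n → ℝ | HasAlternation k z} = ⋃ g : Fin k → Fin n, ⋃ _ : StrictMono g,
      ⋂ m : Fin k, {z : Fin n → ℝ | 0 < (-1) ^ (m : ℕ) * z (g m)} := by
    ext z
    simp [HasAlternation]
  rw [this]
  refine isOpen_iUnion fun g => isOpen_iUnion fun _ => isOpen_iInter_of_finite fun m => ?_
  exact isOpen_lt (by fun_prop) (by fun_prop)

/-- If every entry of `w` has the sign of some entry of `z` at distance at most one, which is
moreover larger in absolute value when it is a neighbour, then `w` alternates no more than `z`. -/
lemma HasAlternation.of_near {n k : ℕ} {w z : Fin n → ℝ} (h : HasAlternation k w)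
    (near : ∀ (s : ℝ) (i : Fin n), 0 < s * w i → s * s = 1 → ∃ j : Fin n,
      (j : ℕ) ≤ i + 1 ∧ (i : ℕ) ≤ j + 1 ∧ 0 < s * z j ∧ (j = i ∨ |z i| < |z j|)) :
    HasAlternation k z := by
  obtain ⟨g, hg, hw⟩ := h
  choose g' h1 h2 h3 h4 using fun m : Fin k => near ((-1) ^ (m : ℕ)) (g m) (hw m)
    (by rw [← mul_pow]; simp)
  refine ⟨g', ?_, h3⟩
  rcases k with _ | k
  · exact fun a => a.elim0
  rw [Fin.strictMono_iff_lt_succ]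
  intro i
  have hlt : (g i.castSucc : ℕ) < g i.succ := hg Fin.castSucc_lt_succ
  have ha1 := h1 i.castSucc
  have ha4 := h4 i.castSucc
  have hb2 := h2 i.succ
  have hb4 := h4 i.succ
  have hne : g' i.castSucc ≠ g' i.succ := by
    intro he
    have e1 := h3 i.castSucc
    have e2 := h3 i.succ
    rw [he] at e1
    simp only [Fin.val_succ, Fin.val_castSucc, pow_succ] at e1 e2
    linarith
  by_contra hcon
  -- Indices move by at most one, so a crossing must exchange two adjacent indices. Each entry of
  -- `z` would then be strictly larger than the other in absolute value.
  have hgt : (g' i.succ : ℕ) < g' i.castSucc :=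
    lt_of_le_of_ne (not_lt.1 hcon) fun h => hne (Fin.ext h.symm)
  have e1 : g' i.castSucc = g i.succ := Fin.ext (by omega)
  have e2 : g' i.succ = g i.castSucc := Fin.ext (by omega)
  rw [e1] at ha4
  rw [e2] at hb4
  have hne' : g i.succ ≠ g i.castSucc := fun h => by rw [h] at hlt; omega
  have := ha4.resolve_left hne'
  have := hb4.resolve_left hne'.symm
  linarith

/-- A small explicit Euler step for a cooperative tridiagonal matrix diminishes variation. -/
lemma IsPositiveTridiagonal.hasAlternation_of_euler {n k : ℕ} {a : Matrix (Fin n) (Fin n) ℝ}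
    (ha : IsPositiveTridiagonal a) {h : ℝ} (h0 : 0 ≤ h) (hle : ∀ i, h * ∑ j, |a i j| ≤ 1)
    {z : Fin n → ℝ} (hz : HasAlternation k (z + h • a.mulVec z)) : HasAlternation k z := by
  refine hz.of_near fun s i hi hs => ?_
  by_cases hzi : 0 < s * z i
  · exact ⟨i, by omega, by omega, hzi, Or.inl rfl⟩
  -- Otherwise `s * z j ≤ |z i|` at each neighbour, so the step adds at most `|z i| = -(s * z i)` to
  -- `s * z i` and cannot make it positive.
  by_contra! hcon
  have hs1 : |s| = 1 := by
    rcases mul_self_eq_one_iff.1 hs with rfl | rfl <;> simp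
  have habs (j : Fin n) : |z j| = |s * z j| := by rw [abs_mul, hs1, one_mul]
  have hterm : ∀ j, s * (a i j * z j) ≤ |a i j| * |z i| := by
    intro j
    by_cases hj : j = i
    · subst hj
      rw [← abs_mul]
      calc s * (a j j * z j) ≤ |s * (a j j * z j)| := le_abs_self _
        _ = _ := by rw [abs_mul, hs1, one_mul]
    by_cases hfar : (i : ℕ) + 1 < j
    · simp [ha.zero_above i j hfar]
    by_cases hfar' : (j : ℕ) + 1 < i
    · simp [ha.zero_below i j hfar']
    have hpos : 0 < a i j := by
      have : (i : ℕ) ≠ j := fun h => hj (Fin.ext h.symm)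
      rcases Nat.lt_or_gt_of_ne this with h | h
      · exact ha.pos_super i j (by omega)
      · exact ha.pos_sub i j (by omega)
    have hsz : s * z j ≤ |z i| := by
      by_cases hp : 0 < s * z j
      · have := (hcon j (by omega) (by omega) hp).2
        rwa [habs j, abs_of_pos hp] at this
      · exact (not_lt.1 hp).trans (abs_nonneg _)
    rw [abs_of_pos hpos]
    calc s * (a i j * z j) = a i j * (s * z j) := by ring
      _ ≤ _ := mul_le_mul_of_nonneg_left hsz hpos.le
  have hsum : s * (a.mulVec z i) ≤ (∑ j, |a i j|) * |z i| := by
    rw [Matrix.mulVec, dotProduct, Finset.mul_sum, Finset.sum_mul]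
    exact Finset.sum_le_sum fun j _ => hterm j
  have hzi' : |z i| = -(s * z i) := by rw [habs i, abs_of_nonpos (not_lt.1 hzi)]
  have e1 := mul_le_mul_of_nonneg_left hsum h0
  have e2 := mul_le_mul_of_nonneg_right (hle i) (abs_nonneg (z i))
  have e3 : s * (z + h • a.mulVec z) i = s * z i + h * (s * a.mulVec z i) := by
    simp only [Pi.add_apply, Pi.smul_apply, smul_eq_mul]; ring
  rw [e3] at hi
  linarith

/-! ### From Euler steps to linear flows -/

/-- A closed set that is preserved by small explicit Euler steps of a linear equation with bounded
coefficients is forward invariant. -/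
lemma mem_of_euler_mem {E : Type*} [NormedAddCommGroup E] [NormedSpace ℝ E] {K : Set E}
    (hK : IsClosed K) {v : ℝ → E} {A : ℝ → E →L[ℝ] E} {M a b : ℝ}
    (hcont : ContinuousOn v (Icc a b))
    (hv : ∀ t ∈ Ico a b, HasDerivWithinAt v (A t (v t)) (Ici t) t)
    (hA : ∀ t ∈ Ico a b, ‖A t‖ ≤ M)
    (hstep : ∀ t ∈ Ico a b, ∀ᶠ h in 𝓝[>] (0 : ℝ), ∀ z ∈ K, z + h • A t z ∈ K)
    (ha : v a ∈ K) : ∀ t ∈ Icc a b, v t ∈ K := by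
  have hne : K.Nonempty := ⟨_, ha⟩
  intro t ht
  rw [hK.mem_iff_infDist_zero hne]
  refine le_antisymm ?_ infDist_nonneg
  have key := le_gronwallBound_of_liminf_deriv_right_le (f := fun t => infDist (v t) K)
    (f' := fun t => M * infDist (v t) K) (δ := 0) (K := M) (ε := 0) (a := a) (b := b)
    ((continuous_infDist_pt K).comp_continuousOn hcont) ?_ (infDist_zero_of_mem ha).le
    (fun x _ => by simp) t ht
  · simpa [gronwallBound_ε0_δ0] using key
  intro x hx r hr
  refine Eventually.frequently ?_
  -- Half of the slack absorbs the error of the Euler approximation, keeping the final inequality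
  -- strict.
  have hε : 0 < (r - M * infDist (v x) K) / 2 := by linarith
  have hlit := (hasDerivWithinAt_iff_isLittleO.1 (hv x hx)).def hε
  have hlit' := hlit.filter_mono (nhdsWithin_mono x Ioi_subset_Ici_self)
  have hst : ∀ᶠ z in 𝓝[>] x, ∀ y ∈ K, y + (z - x) • A x y ∈ K := by
    have : Tendsto (fun z => z - x) (𝓝[>] x) (𝓝[>] 0) := by
      refine tendsto_nhdsWithin_iff.2 ⟨?_, ?_⟩
      · have : Tendsto (fun z => z - x) (𝓝 x) (𝓝 (x - x)) := by
          exact (continuous_id.sub continuous_const).tendsto x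
        rw [sub_self] at this
        exact this.mono_left nhdsWithin_le_nhds
      · filter_upwards [self_mem_nhdsWithin] with z hz
        exact mem_Ioi.2 (sub_pos.2 (mem_Ioi.1 hz))
    exact this.eventually (hstep x hx)
  filter_upwards [hlit', hst, self_mem_nhdsWithin] with z hz1 hz2 hz3
  have hpos : 0 < z - x := sub_pos.2 hz3
  have hM : 0 ≤ M := (norm_nonneg _).trans (hA x hx)
  have h1M : 0 < 1 + (z - x) * M := by positivity
  rw [Real.norm_of_nonneg hpos.le] at hz1
  -- The Euler map sends `K` into `K` and has Lipschitz constant at most `1 + (z - x) * M`.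
  have hB : infDist (v x + (z - x) • A x (v x)) K ≤ (1 + (z - x) * M) * infDist (v x) K := by
    rw [← div_le_iff₀' h1M, le_infDist hne]
    intro y hy
    rw [div_le_iff₀' h1M]
    refine (infDist_le_dist_of_mem (hz2 y hy)).trans ?_
    rw [dist_eq_norm, dist_eq_norm]
    have : v x + (z - x) • A x (v x) - (y + (z - x) • A x y) =
        (v x - y) + (z - x) • A x (v x - y) := by
      rw [map_sub, smul_sub]; abel
    rw [this]
    refine (norm_add_le _ _).trans ?_
    rw [norm_smul, Real.norm_of_nonneg hpos.le]
    have := mul_le_mul_of_nonneg_left ((A x).le_of_opNorm_le (hA x hx) (v x - y)) hpos.le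
    linarith
  have hC : infDist (v z) K ≤ infDist (v x + (z - x) • A x (v x)) K +
      (r - M * infDist (v x) K) / 2 * (z - x) := by
    have := infDist_le_infDist_add_dist (s := K) (x := v z) (y := v x + (z - x) • A x (v x))
    rw [dist_eq_norm, ← sub_sub] at this
    linarith
  rw [inv_mul_lt_iff₀ hpos]
  nlinarith

/-- Alternations of a solution of a cooperative tridiagonal linear equation persist backwards. -/
lemma HasAlternation.of_later {n k : ℕ} {v : ℝ → Fin n → ℝ}
    {A : ℝ → (Fin n → ℝ) →L[ℝ] (Fin n → ℝ)} {M : ℝ}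
    (hv : ∀ t ∈ Ici (0 : ℝ), HasDerivWithinAt v (A t (v t)) (Ici 0) t)
    (hA : ∀ t ∈ Ici (0 : ℝ), ‖A t‖ ≤ M)
    (htri : ∀ t ∈ Ici (0 : ℝ), IsPositiveTridiagonal
      (LinearMap.toMatrix' (A t : (Fin n → ℝ) →ₗ[ℝ] (Fin n → ℝ))))
    {s t : ℝ} (hs : 0 ≤ s) (hst : s ≤ t) (h : HasAlternation k (v t)) :
    HasAlternation k (v s) := by
  by_contra hcon
  have hsub : Icc s t ⊆ Ici (0 : ℝ) := fun x hx => hs.trans hx.1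
  refine mem_of_euler_mem (K := {z : Fin n → ℝ | HasAlternation k z}ᶜ)
    (isOpen_hasAlternation n k).isClosed_compl (a := s) (b := t)
    (fun x hx => ((hv x (hsub hx)).continuousWithinAt).mono hsub)
    (fun x hx => (hv x (hsub (Ico_subset_Icc_self hx))).mono
      (Ici_subset_Ici.2 (hs.trans hx.1)))
    (fun x hx => hA x (hsub (Ico_subset_Icc_self hx))) ?_ hcon t (right_mem_Icc.2 hst) h
  intro x hx
  have ht := htri x (hsub (Ico_subset_Icc_self hx))
  set a := LinearMap.toMatrix' (A x : (Fin n → ℝ) →ₗ[ℝ] (Fin n → ℝ)) with ha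
  have hev : ∀ᶠ h in 𝓝[>] (0 : ℝ), ∀ i, h * ∑ j, |a i j| ≤ 1 := by
    refine eventually_all.2 fun i => ?_
    have : Tendsto (fun h : ℝ => h * ∑ j, |a i j|) (𝓝 0) (𝓝 (0 * ∑ j, |a i j|)) :=
      (continuous_id.mul continuous_const).tendsto 0
    rw [zero_mul] at this
    exact (this.mono_left nhdsWithin_le_nhds).eventually (eventually_le_nhds one_pos)
  filter_upwards [hev, self_mem_nhdsWithin] with h hh hpos z hz halt
  refine hz (ht.hasAlternation_of_euler (le_of_lt hpos) hh ?_)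
  rwa [ha, LinearMap.toMatrix'_mulVec]

/-- The first component of a solution of a cooperative tridiagonal linear equation
eventually does not change sign. -/
lemma eventually_nonneg_or_eventually_nonpos {n : ℕ} {v : ℝ → Fin (n + 1) → ℝ}
    {A : ℝ → (Fin (n + 1) → ℝ) →L[ℝ] (Fin (n + 1) → ℝ)} {M : ℝ}
    (hv : ∀ t ∈ Ici (0 : ℝ), HasDerivWithinAt v (A t (v t)) (Ici 0) t)
    (hA : ∀ t ∈ Ici (0 : ℝ), ‖A t‖ ≤ M)
    (htri : ∀ t ∈ Ici (0 : ℝ), IsPositiveTridiagonal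
      (LinearMap.toMatrix' (A t : (Fin (n + 1) → ℝ) →ₗ[ℝ] (Fin (n + 1) → ℝ)))) :
    (∀ᶠ t in atTop, 0 ≤ v t 0) ∨ ∀ᶠ t in atTop, v t 0 ≤ 0 := by
  by_contra! hcon
  obtain ⟨hneg, hpos⟩ := hcon
  have hv' : ∀ t ∈ Ici (0 : ℝ), HasDerivWithinAt (-v) (A t ((-v) t)) (Ici 0) t := fun t ht => by
    simpa using (hv t ht).neg
  -- Both signs are carried together: at a later time when the first entry is positive, a pattern of
  -- `-v` extends to a longer one of `v`, which then persists backwards; likewise with `v` and `-v`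
  -- exchanged.
  have key : ∀ k : ℕ, ∀ t, 0 ≤ t → HasAlternation k (v t) ∧ HasAlternation k (-v t) := by
    intro k
    induction k with
    | zero => exact fun t _ => ⟨hasAlternation_zero _, hasAlternation_zero _⟩
    | succ k ih =>
      intro t ht
      constructor
      · obtain ⟨s, hts, hs⟩ := (Filter.frequently_atTop.1 hpos) t
        have hs0 := ht.trans hts
        exact ((ih s hs0).2.succ_of_neg (by simpa using hs)).of_later hv hA htri ht hts
      · obtain ⟨s, hts, hs⟩ := (Filter.frequently_atTop.1 hneg) t
        have hs0 := ht.trans hts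
        have hk : HasAlternation (k + 1) ((-v) s) :=
          HasAlternation.succ_of_neg (by simpa using (ih s hs0).1) (by simpa using hs)
        exact hk.of_later hv' hA htri ht hts
  have := (key (n + 2) 0 le_rfl).1.le
  omega

/-! ### Propagation of zeros along the super-diagonal -/

lemma fderiv_apply_eq_sum {n : ℕ} (f : (Fin n → ℝ) → (Fin n → ℝ)) (x u : Fin n → ℝ) (i : Fin n) :
    fderiv ℝ f x u i = ∑ j, jacobian f x i j * u j := by
  have := LinearMap.toMatrix'_mulVec (fderiv ℝ f x : (Fin n → ℝ) →ₗ[ℝ] (Fin n → ℝ)) u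
  exact (congrFun this i).symm

/-- If all the entries of `u` up to the `i`-th vanish and so does the `i`-th entry of `a u`, then
the next entry of `u` vanishes. -/
lemma IsPositiveTridiagonal.eq_zero_of_sum_eq_zero {n : ℕ} {a : Matrix (Fin n) (Fin n) ℝ}
    (ha : IsPositiveTridiagonal a) {u : Fin n → ℝ} {i k : Fin n} (hk : (i : ℕ) + 1 = k)
    (hu : ∀ j ≤ i, u j = 0) (h : ∑ j, a i j * u j = 0) : u k = 0 := by
  rw [Finset.sum_eq_single k] at h
  · exact (mul_eq_zero.1 h).resolve_left (ha.pos_super i k hk).ne'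
  · intro j _ hj
    rcases le_or_gt j i with h | h
    · rw [hu j h, mul_zero]
    · have h1 : (i : ℕ) < j := h
      have h2 : (j : ℕ) ≠ k := fun h => hj (Fin.ext h)
      rw [ha.zero_above i j (by omega), zero_mul]
  · simp

lemma Fin.forall_of_zero_of_succ {n : ℕ} {P : Fin (n + 1) → Prop} (h0 : P 0)
    (hs : ∀ i k : Fin (n + 1), (i : ℕ) + 1 = k → (∀ j ≤ i, P j) → P k) : ∀ i, P i := by
  have : ∀ m : ℕ, ∀ i : Fin (n + 1), (i : ℕ) ≤ m → P i := by
    intro m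
    induction m with
    | zero =>
      intro i hi
      have : i = 0 := Fin.ext (by simpa using hi)
      rwa [this]
    | succ m ih =>
      intro i hi
      rcases Nat.lt_or_ge m i with h | h
      · refine hs ⟨m, by omega⟩ i (by simp only; omega) fun j hj => ih j ?_
        exact hj
      · exact ih i h
  exact fun i => this i i le_rfl

/-- Two zeros with the same first component, of a map whose Jacobian is positive tridiagonal on a
convex set, coincide. -/
lemma eq_of_eq_zero_of_apply_zero_eq {n : ℕ} {f : (Fin (n + 1) → ℝ) → (Fin (n + 1) → ℝ)}
    {Ω : Set (Fin (n + 1) → ℝ)} (hconvex : Convex ℝ Ω) (hf : ∀ x ∈ Ω, DifferentiableAt ℝ f x)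
    (hJ : ∀ x ∈ Ω, IsPositiveTridiagonal (jacobian f x)) {p q : Fin (n + 1) → ℝ}
    (hp : p ∈ Ω) (hq : q ∈ Ω) (hfp : f p = 0) (hfq : f q = 0) (h0 : p 0 = q 0) : p = q := by
  suffices ∀ i, (p - q) i = 0 from sub_eq_zero.1 (funext this)
  refine Fin.forall_of_zero_of_succ (by simp [h0]) fun i k hk hu => ?_
  have hseg : ∀ s ∈ Icc (0 : ℝ) 1, q + s • (p - q) ∈ Ω := fun s hs => by
    have := hconvex hq hp (sub_nonneg.2 hs.2) hs.1 (by ring)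
    convert this using 1
    module
  have hd : ∀ s ∈ Icc (0 : ℝ) 1, HasDerivAt (fun s : ℝ => f (q + s • (p - q)) i)
      (fderiv ℝ f (q + s • (p - q)) (p - q) i) s := by
    intro s hs
    have h1 : HasDerivAt (fun s : ℝ => q + s • (p - q)) (p - q) s := by
      simpa using ((hasDerivAt_id s).smul_const (p - q)).const_add q
    exact hasDerivAt_pi.1 (((hf _ (hseg s hs)).hasFDerivAt).comp_hasDerivAt s h1) i
  -- Rolle for the `i`-th component of `f`, zero at both ends: row `i` of the Jacobian at an
  -- intermediate point annihilates `p - q`.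
  obtain ⟨s, hs, hz⟩ := exists_hasDerivAt_eq_zero (zero_lt_one' ℝ)
    (fun s hs => (hd s hs).continuousAt.continuousWithinAt) (by simp [hfp, hfq])
    (fun s hs => hd s (Ioo_subset_Icc_self hs))
  rw [fderiv_apply_eq_sum] at hz
  exact (hJ _ (hseg s (Ioo_subset_Icc_self hs))).eq_zero_of_sum_eq_zero hk hu hz

/-! ### Uniqueness, velocity and monotone convergence -/

/-- A solution that starts at `x₀` agrees with one that stays in the region where `f` is `C¹`. -/
lemma IsForwardSolution.eq_of_mem {n : ℕ} {f : (Fin n → ℝ) → (Fin n → ℝ)} {U : Set (Fin n → ℝ)}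
    (hU : IsOpen U) (hf : ContDiffOn ℝ 1 f U) {x₀ : Fin n → ℝ} {x y : ℝ → Fin n → ℝ}
    (hx : IsForwardSolution f x₀ x) (hy : IsForwardSolution f x₀ y)
    (hyU : ∀ t, 0 ≤ t → y t ∈ U) : ∀ t, 0 ≤ t → x t = y t := by
  intro T hT
  have hcx : ContinuousOn x (Ici 0) := fun t ht => (hx.2 t ht).continuousWithinAt
  have hcy : ContinuousOn y (Ici 0) := fun t ht => (hy.2 t ht).continuousWithinAt
  have hclosed : IsClosed ({t | x t = y t} ∩ Icc 0 T) := by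
    have h1 : ContinuousOn (fun t => x t - y t) (Icc 0 T) :=
      (hcx.sub hcy).mono fun t ht => ht.1
    have := h1.preimage_isClosed_of_isClosed isClosed_Icc (isClosed_singleton (x := 0))
    convert this using 1
    ext t
    simp [sub_eq_zero, and_comm]
  -- The agreement set is closed; local Lipschitz continuity of `f` near `y t` extends it to the
  -- right. This needs only `y` to stay in `U`.
  refine hclosed.Icc_subset_of_forall_mem_nhdsWithin (hx.1.trans hy.1.symm) ?_ (right_mem_Icc.2 hT)
  rintro t ⟨hxy : x t = y t, ht⟩
  obtain ⟨K, s, hs, hlip⟩ :=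
    ((hf.contDiffAt (hU.mem_nhds (hyU t ht.1))).exists_lipschitzOnWith)
  have hsub : Ici t ⊆ Ici 0 := Ici_subset_Ici.2 ht.1
  have hxs : ∀ᶠ r in 𝓝[≥] t, x r ∈ s :=
    ((hcx t ht.1).mono hsub).preimage_mem_nhdsWithin (by rwa [hxy])
  have hys : ∀ᶠ r in 𝓝[≥] t, y r ∈ s :=
    ((hcy t ht.1).mono hsub).preimage_mem_nhdsWithin hs
  obtain ⟨b, hb, hbs⟩ := mem_nhdsGE_iff_exists_Icc_subset.1 (hxs.and hys)
  have hb' : t < b := hb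
  have hIcc : Icc t b ⊆ Ici 0 := fun r hr => ht.1.trans hr.1
  have heq := ODE_solution_unique_of_mem_Icc_right (v := fun _ => f) (s := fun _ => s) (K := K)
    (fun _ _ => hlip)
    (hcx.mono hIcc)
    (fun r hr => (hx.2 r (hIcc (Ico_subset_Icc_self hr))).mono
      (Ici_subset_Ici.2 (ht.1.trans hr.1)))
    (fun r hr => (hbs (Ico_subset_Icc_self hr)).1)
    (hcy.mono hIcc)
    (fun r hr => (hy.2 r (hIcc (Ico_subset_Icc_self hr))).mono
      (Ici_subset_Ici.2 (ht.1.trans hr.1)))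
    (fun r hr => (hbs (Ico_subset_Icc_self hr)).2)
    hxy
  exact mem_of_superset (Ioc_mem_nhdsGT hb') fun r hr => heq (Ioc_subset_Icc_self hr)

/-- The velocity of a solution solves the linearized equation. -/
lemma IsForwardSolution.hasDerivWithinAt_velocity {n : ℕ} {f : (Fin n → ℝ) → (Fin n → ℝ)}
    {x₀ : Fin n → ℝ} {x : ℝ → Fin n → ℝ} (hx : IsForwardSolution f x₀ x)
    (hf : ∀ t, 0 ≤ t → DifferentiableAt ℝ f (x t)) :
    ∀ t ∈ Ici (0 : ℝ), HasDerivWithinAt (fun t => f (x t)) (fderiv ℝ f (x t) (f (x t))) (Ici 0) t :=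
  fun t ht => ((hf t ht).hasFDerivAt).comp_hasDerivWithinAt t (hx.2 t ht)

/-- A bounded function on `[0, ∞)` whose derivative is eventually nonnegative converges. -/
lemma exists_tendsto_of_eventually_deriv_nonneg {g g' : ℝ → ℝ}
    (hg : ∀ t ∈ Ici (0 : ℝ), HasDerivWithinAt g (g' t) (Ici 0) t)
    (hbdd : BddAbove (g '' Ici 0)) (hpos : ∀ᶠ t in atTop, 0 ≤ g' t) :
    ∃ c, Tendsto g atTop (𝓝 c) := by
  obtain ⟨T, hT'⟩ := eventually_atTop.1 (hpos.and (eventually_ge_atTop 0))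
  have hT0 : 0 ≤ T := (hT' T le_rfl).2
  have hT : ∀ t ∈ Ici T, 0 ≤ g' t := fun t ht => (hT' t ht).1
  have hsub : Ici T ⊆ Ici 0 := Ici_subset_Ici.2 hT0
  have hmono : MonotoneOn g (Ici T) := by
    refine monotoneOn_of_hasDerivWithinAt_nonneg (f' := g') (convex_Ici T)
      (fun t ht => (hg t (hsub ht)).continuousWithinAt.mono hsub)
      (fun t ht => (hg t (hsub (interior_subset ht))).mono (interior_subset.trans hsub))
      (fun t ht => hT t (interior_subset ht))
  have hm : Monotone fun t => g (max t T) := fun s t hst =>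
    hmono (le_max_right s T) (le_max_right t T) (max_le_max hst le_rfl)
  have hb : BddAbove (range fun t => g (max t T)) := by
    refine hbdd.mono ?_
    rintro _ ⟨t, rfl⟩
    exact ⟨max t T, hT0.trans (le_max_right t T), rfl⟩
  refine ⟨_, (tendsto_atTop_ciSup hm hb).congr' ?_⟩
  filter_upwards [eventually_ge_atTop T] with t ht
  rw [max_eq_left ht]

lemma exists_tendsto_of_eventually_deriv_nonneg_or_nonpos {g g' : ℝ → ℝ}
    (hg : ∀ t ∈ Ici (0 : ℝ), HasDerivWithinAt g (g' t) (Ici 0) t)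
    (habove : BddAbove (g '' Ici 0)) (hbelow : BddBelow (g '' Ici 0))
    (h : (∀ᶠ t in atTop, 0 ≤ g' t) ∨ ∀ᶠ t in atTop, g' t ≤ 0) :
    ∃ c, Tendsto g atTop (𝓝 c) := by
  rcases h with h | h
  · exact exists_tendsto_of_eventually_deriv_nonneg hg habove h
  · obtain ⟨c, hc⟩ := exists_tendsto_of_eventually_deriv_nonneg (g := -g) (g' := -g')
      (fun t ht => (hg t ht).neg) (by
        obtain ⟨B, hB⟩ := hbelow
        refine ⟨-B, ?_⟩
        rintro _ ⟨t, ht, rfl⟩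
        exact neg_le_neg (hB ⟨t, ht, rfl⟩))
      (h.mono fun t ht => by simpa using ht)
    exact ⟨-c, by simpa using hc.neg⟩

/-! ### Omega-limit solutions and convergence -/

/-- If the first component of a solution is constant, then the solution starts at an
equilibrium. -/
lemma IsForwardSolution.eq_zero_of_apply_zero_const {n : ℕ}
    {f : (Fin (n + 1) → ℝ) → (Fin (n + 1) → ℝ)} {y : Fin (n + 1) → ℝ} {Y : ℝ → Fin (n + 1) → ℝ}
    (hY : IsForwardSolution f y Y) (hf : ∀ t, 0 ≤ t → DifferentiableAt ℝ f (Y t))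
    (hJ : ∀ t, 0 ≤ t → IsPositiveTridiagonal (jacobian f (Y t))) {c : ℝ}
    (hc : ∀ t, 0 ≤ t → Y t 0 = c) : f y = 0 := by
  have hconst {g : ℝ → ℝ} {d d' t : ℝ} (ht : 0 ≤ t) (hg : HasDerivWithinAt g d' (Ici 0) t)
      (h : ∀ t, 0 ≤ t → g t = d) : d' = 0 :=
    (uniqueDiffOn_Ici 0 t ht).eq_deriv (Ici 0) hg
      ((hasDerivWithinAt_const t (Ici 0) d).congr (fun t ht => h t ht) (h t ht))
  -- Quantifying over all times lets the vanishing of entry `i` be differentiated, which makes row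
  -- `i` of the linearized equation vanish.
  have key : ∀ i, ∀ t, 0 ≤ t → f (Y t) i = 0 := by
    refine Fin.forall_of_zero_of_succ (fun t ht => ?_) fun i k hk hu t ht => ?_
    · exact hconst ht (hasDerivWithinAt_pi.1 (hY.2 t ht) 0) hc
    · refine (hJ t ht).eq_zero_of_sum_eq_zero hk (fun j hj => hu j hj t ht) ?_
      rw [← fderiv_apply_eq_sum]
      exact hconst ht (hasDerivWithinAt_pi.1 (hY.hasDerivWithinAt_velocity hf t ht) i)
        (hu i le_rfl)
  rw [← hY.1]
  exact funext fun i => key i 0 le_rfl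

/-- If the first component of a solution converges, then along every omega-limit solution it is
constant. -/
lemma IsForwardSolution.apply_eq_of_mapClusterPt {n : ℕ} {f : (Fin n → ℝ) → (Fin n → ℝ)}
    {Ω : Set (Fin n → ℝ)} {K : NNReal} (hlip : LipschitzOnWith K f Ω) {x₀ y : Fin n → ℝ}
    {x Y : ℝ → Fin n → ℝ} (hx : IsForwardSolution f x₀ x) (hxΩ : ∀ t, 0 ≤ t → x t ∈ Ω)
    (hY : IsForwardSolution f y Y) (hYΩ : ∀ t, 0 ≤ t → Y t ∈ Ω) (hy : MapClusterPt y atTop x)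
    {i : Fin n} {c : ℝ} (hc : Tendsto (fun t => x t i) atTop (𝓝 c)) {t : ℝ} (ht : 0 ≤ t) :
    Y t i = c := by
  obtain ⟨F, hF, hFy⟩ := mapClusterPt_iff_ultrafilter.1 hy
  -- Gronwall compares the time-shifted solution with `Y`. Along the ultrafilter `F` the initial gap
  -- tends to zero while `t` stays fixed.
  have hbound : ∀ τ, 0 ≤ τ → dist (x (τ + t)) (Y t) ≤ dist (x τ) y * Real.exp (K * t) := by
    intro τ hτ
    have hder : ∀ r ∈ Ici (0 : ℝ), HasDerivWithinAt (fun r => x (τ + r)) (f (x (τ + r)))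
        (Ici 0) r := by
      intro r hr
      have h1 : HasDerivWithinAt (fun r => τ + r) 1 (Ici 0) r :=
        ((hasDerivAt_id r).const_add τ).hasDerivWithinAt
      have := (hx.2 (τ + r) (add_nonneg hτ hr)).scomp r h1
        (fun s hs => add_nonneg hτ hs)
      simpa [Function.comp_def] using this
    have hsub : Icc 0 t ⊆ Ici 0 := Icc_subset_Ici_self
    have := dist_le_of_trajectories_ODE_of_mem (v := fun _ => f) (s := fun _ => Ω) (K := K)
      (f := fun r => x (τ + r)) (g := Y) (a := 0) (b := t) (δ := dist (x τ) y)
      (fun _ _ => hlip)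
      (fun r hr => (hder r (hsub hr)).continuousWithinAt.mono hsub)
      (fun r hr => (hder r hr.1).mono (Ici_subset_Ici.2 hr.1))
      (fun r hr => hxΩ _ (add_nonneg hτ hr.1))
      (fun r hr => (hY.2 r (hsub hr)).continuousWithinAt.mono hsub)
      (fun r hr => (hY.2 r hr.1).mono (Ici_subset_Ici.2 hr.1))
      (fun r hr => hYΩ _ hr.1)
      (by simp [hY.1]) t (right_mem_Icc.2 ht)
    simpa using this
  have hlim : Tendsto (fun τ => x (τ + t)) F (𝓝 (Y t)) := by
    rw [tendsto_iff_dist_tendsto_zero]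
    have h0 : Tendsto (fun τ => dist (x τ) y * Real.exp (K * t)) F (𝓝 0) := by
      simpa using (tendsto_iff_dist_tendsto_zero.1 hFy).mul_const (Real.exp (K * t))
    refine squeeze_zero' (Eventually.of_forall fun _ => dist_nonneg) ?_ h0
    exact ((eventually_ge_atTop 0).filter_mono hF).mono hbound
  exact tendsto_nhds_unique (tendsto_pi_nhds.1 hlim i)
    ((hc.comp (tendsto_atTop_add_const_right atTop t tendsto_id)).mono_left hF)

theorem mainTheorem2 {n : ℕ} (f : (Fin n → ℝ) → (Fin n → ℝ)) (U Ω : Set (Fin n → ℝ))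
    (hU : IsOpen U) (hΩU : Ω ⊆ U) (hf : ContDiffOn ℝ 1 f U)
    (hcompact : IsCompact Ω) (hconvex : Convex ℝ Ω) (hinv : EvolvesOn f Ω)
    (hJ : ∀ x ∈ Ω, IsPositiveTridiagonal (jacobian f x)) :
    ∀ x₀ ∈ Ω, ∀ x : ℝ → Fin n → ℝ, IsForwardSolution f x₀ x →
      ∃ p ∈ Ω, f p = 0 ∧ Filter.Tendsto x Filter.atTop (nhds p) := by
  intro x₀ hx₀ x hx
  -- In dimension zero there is no first coordinate, and the space is a single point.
  rcases n with _ | n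
  · exact ⟨x₀, hx₀, Subsingleton.elim _ _, by
      rw [Subsingleton.elim x fun _ => x₀]; exact tendsto_const_nhds⟩
  have hdiff : ∀ z ∈ Ω, DifferentiableAt ℝ f z := fun z hz =>
    (hf.contDiffAt (hU.mem_nhds (hΩU hz))).differentiableAt one_ne_zero
  obtain ⟨M, hM⟩ : ∃ M, ∀ z ∈ Ω, ‖fderiv ℝ f z‖ ≤ M :=
    hcompact.exists_bound_of_continuousOn ((hf.continuousOn_fderiv_of_isOpen hU le_rfl).mono hΩU)
  have hlip : LipschitzOnWith M.toNNReal f Ω :=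
    hconvex.lipschitzOnWith_of_nnnorm_hasFDerivWithin_le
      (fun z hz => (hdiff z hz).hasFDerivAt.hasFDerivWithinAt)
      (fun z hz => by
        rw [← NNReal.coe_le_coe, coe_nnnorm]
        exact (hM z hz).trans (Real.le_coe_toNNReal M))
  have hxΩ : ∀ t, 0 ≤ t → x t ∈ Ω := by
    obtain ⟨y, hy, hyΩ⟩ := hinv x₀ hx₀
    intro t ht
    rw [hx.eq_of_mem hU hf hy (fun t ht => hΩU (hyΩ t ht)) t ht]
    exact hyΩ t ht
  have hsign := eventually_nonneg_or_eventually_nonpos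
    (hx.hasDerivWithinAt_velocity fun t ht => hdiff _ (hxΩ t ht))
    (fun t ht => hM _ (hxΩ t ht)) (fun t ht => hJ _ (hxΩ t ht))
  have hcomp : IsCompact ((fun z : Fin (n + 1) → ℝ => z 0) '' Ω) :=
    hcompact.image (continuous_apply 0)
  have hsub : (fun t => x t 0) '' Ici 0 ⊆ (fun z : Fin (n + 1) → ℝ => z 0) '' Ω := by
    rintro _ ⟨t, ht, rfl⟩
    exact ⟨x t, hxΩ t ht, rfl⟩
  obtain ⟨c, hc⟩ := exists_tendsto_of_eventually_deriv_nonneg_or_nonpos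
    (fun t ht => hasDerivWithinAt_pi.1 (hx.2 t ht) 0)
    (hcomp.bddAbove.mono hsub) (hcomp.bddBelow.mono hsub) hsign
  have hlimit : ∀ y ∈ Ω, MapClusterPt y atTop x → f y = 0 ∧ y 0 = c := by
    intro y hy hcl
    obtain ⟨Y, hY, hYΩ⟩ := hinv y hy
    have hYc : ∀ t, 0 ≤ t → Y t 0 = c := fun t ht =>
      hx.apply_eq_of_mapClusterPt hlip hxΩ hY hYΩ hcl hc ht
    refine ⟨hY.eq_zero_of_apply_zero_const (fun t ht => hdiff _ (hYΩ t ht))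
      (fun t ht => hJ _ (hYΩ t ht)) hYc, ?_⟩
    rw [← hYc 0 le_rfl, hY.1]
  have hmem : ∀ᶠ t in atTop, x t ∈ Ω := (eventually_ge_atTop 0).mono hxΩ
  obtain ⟨p, hp, hpcl⟩ := hcompact.exists_mapClusterPt_of_frequently hmem.frequently
  obtain ⟨hfp, hp0⟩ := hlimit p hp hpcl
  refine ⟨p, hp, hfp, hcompact.tendsto_nhds_of_unique_mapClusterPt hmem fun q hq hqcl => ?_⟩
  obtain ⟨hfq, hq0⟩ := hlimit q hq hqcl
  exact eq_of_eq_zero_of_apply_zero_eq hconvex hdiff hJ hq hp hfq hfp (hq0.trans hp0.symm)
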